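/- **Setting.** A higher derivation in $n$ variables on a commutative ring $R$ is a ring homomorphism $\theta:R\to R[[T_1,\dots,T_n]]$ with $\theta(r)|_{T=0}=r$ for all $r\in R$; for $\alpha\in\mathbb N^n$ let $\theta^{(\alpha)}(r)$ denote the coefficient of $T^\alpha$ in $\theta(r)$, and put $|\alpha|=\alpha_1+\dots+\alpha_n$. Let $K$ be a field of arbitrary characteristic and let $F/K$ be a field extension of transcendence degree $n$. A separating transcendence basis of $F/K$ is a transcendence basis $t=(t_1,\dots,t_n)$ such that $F$ is separable algebraic over $K(t_1,\dots,t_n)$. For such a $t$ there is exactly one higher derivation $\theta_t:F\to F[[T_1,\dots,T_n]]$ with $\theta_t(a)=a$ for $a\in K$ and $\theta_t(t_i)=t_i+T_i$ for all $i$. For two separating transcendence bases $s,t$ of $F/K$ let $J(t,s)=\bigl(\theta_s^{(e_l)}(t_j)\bigr)_{1\le j,l\le n}$ be the Jacobian matrix, where $e_l\in\mathbb N^n$ is the $l$-th unit vector. **Theorem.** Let $n\in\mathbb N$, $\mu\in\mathbb N^n\setminus\{0\}$, $m=|\mu|$ and $1\le i\le n$. There is a polynomial $$P\in\mathbb Z\bigl[X_{\lambda,j}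 : \lambda\in\mathbb N^n,\ 0<|\lambda|\le m,\ 1\le j\le n\bigr][D]$$ whose degree in $D$ is at most $\binom{n+m}{n+1}$, such that for every field extension $F/K$ of transcendence degree $n$ and any two separating transcendence bases $s=(s_1,\dots,s_n)$ and $t=(t_1,\dots,t_n)$ of $F/K$ one has $\det J(t,s)\neq 0$ and $$\theta_t^{(\mu)}(s_i)=P\Bigl(\bigl(\theta_s^{(\lambda)}(t_j)\bigr)_{\lambda,j},\ \det(J(t,s))^{-1}\Bigr).$$ In particular, $\theta_t^{(\mu)}(s_i)$ is a polynomial with integer coefficients in the $\theta_s^{(\lambda)}(t_j)$ with $0<|\lambda|\le|\mu|$ and in $\det(J(t,s))^{-1}$, of degree at most $\binom{n+m}{n+1}$ in the latter. -/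

import Mathlib

/-- An `n`-variate higher derivation on a commutative ring `R`: a ring homomorphism
`R → R[[T_1, …, T_n]]` whose composition with `T ↦ 0` is the identity of `R`. -/
structure HigherDerivation (n : ℕ) (R : Type*) [CommRing R] where
  toRingHom : R →+* MvPowerSeries (Fin n) R
  constantCoeff_toRingHom : ∀ r : R, MvPowerSeries.constantCoeff (toRingHom r) = r

/-- The component `θ^(α) : R → R` of a higher derivation: `θ^(α)(r)` is the coefficient of `T^α`
in `θ(r)`. -/
noncomputable def HigherDerivation.component {n : ℕ} {R : Type*} [CommRing R]
    (θ : HigherDerivation n R) (α : Fin n →₀ ℕ) (r : R) : R :=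
  MvPowerSeries.coeff α (θ.toRingHom r)

/-- The family `t_1, …, t_n` is a separating transcendence basis of `F` over `K`: it is a
transcendence basis, and `F` is separable algebraic over `K(t_1, …, t_n)`. -/
structure IsSeparatingTranscendenceBasis (K : Type*) {F : Type*} [Field K] [Field F] [Algebra K F]
    {n : ℕ} (t : Fin n → F) : Prop where
  isTranscendenceBasis : IsTranscendenceBasis K t
  isSeparable : Algebra.IsSeparable (IntermediateField.adjoin K (Set.range t)) F

/-- A higher derivation on `F` extends the higher derivation with respect to `t_1, …, t_n` on
`K[t_1, …, t_n]`: it is trivial on `K` and maps `t_i` to `t_i + T_i`. -/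
structure HigherDerivation.ExtendsWithRespectTo (K : Type*) {F : Type*} [Field K] [Field F]
    [Algebra K F] {n : ℕ} (θ : HigherDerivation n F) (t : Fin n → F) : Prop where
  map_algebraMap : ∀ a : K, θ.toRingHom (algebraMap K F a) = MvPowerSeries.C (algebraMap K F a)
  map_basis : ∀ i : Fin n, θ.toRingHom (t i) = MvPowerSeries.C (t i) + MvPowerSeries.X i

/-- Power series with the same constant coefficient agree modulo the ideal `(T_1, …, T_n)`. -/
theorem mk_eq_mk_of_constantCoeff_eq {n : ℕ} {R : Type*} [CommRing R]
    {f g : MvPowerSeries (Fin n) R}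
    (h : MvPowerSeries.constantCoeff f = MvPowerSeries.constantCoeff g) :
    Ideal.Quotient.mk (Ideal.span (Set.range (MvPowerSeries.X (σ := Fin n) (R := R)))) f =
      Ideal.Quotient.mk (Ideal.span (Set.range (MvPowerSeries.X (σ := Fin n) (R := R)))) g := by
  classical
  rw [Ideal.Quotient.eq]
  have h0 : MvPowerSeries.coeff 0 (f - g) = 0 := by
    simpa [sub_eq_zero] using h
  generalize f - g = p at h0
  have hc : ∀ α : Fin n →₀ ℕ, α ≠ 0 → ∃ i, α i ≠ 0 := fun α hα => by
    simpa using Finsupp.ne_iff.mp hα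
  rcases isEmpty_or_nonempty (Fin n) with hn | hn
  · have hp : p = 0 := by
      ext α
      rw [Subsingleton.elim α 0, h0, map_zero]
    rw [hp]
    exact Ideal.zero_mem _
  choose! c hc using hc
  let q : Fin n → MvPowerSeries (Fin n) R := fun i β =>
    if c (β + Finsupp.single i 1) = i then MvPowerSeries.coeff (β + Finsupp.single i 1) p else 0
  have hq : ∀ (i : Fin n) (α : Fin n →₀ ℕ), α ≠ 0 →
      MvPowerSeries.coeff α (MvPowerSeries.X i * q i) =
        if c α = i then MvPowerSeries.coeff α p else 0 := by
    intro i α hα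
    rw [MvPowerSeries.X, MvPowerSeries.coeff_monomial_mul, one_mul]
    by_cases hi : Finsupp.single i 1 ≤ α
    · rw [if_pos hi]
      change (if c (α - Finsupp.single i 1 + Finsupp.single i 1) = i then
        MvPowerSeries.coeff (α - Finsupp.single i 1 + Finsupp.single i 1) p else 0) = _
      rw [tsub_add_cancel_of_le hi]
    · rw [if_neg hi, if_neg]
      rintro rfl
      exact hi (by simpa [Nat.one_le_iff_ne_zero] using hc α hα)
  have hp : p = ∑ i, MvPowerSeries.X i * q i := by
    ext α
    rw [map_sum]
    by_cases hα : α = 0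
    · subst hα
      simp only [h0, MvPowerSeries.coeff_zero_X_mul, Finset.sum_const_zero]
    · simp [hq _ α hα]
  rw [hp]
  exact Ideal.sum_mem _ fun i _ =>
    Ideal.mul_mem_right _ _ (Ideal.subset_span (Set.mem_range_self i))

/-- A higher derivation extends uniquely along a formally étale ring extension. -/
theorem HigherDerivation.existsUnique_extension {n : ℕ} {A R : Type*} [CommRing A] [CommRing R]
    [Algebra A R] [Algebra.FormallyEtale A R] (ψ : A →+* MvPowerSeries (Fin n) R)
    (hψ : ∀ a, MvPowerSeries.constantCoeff (ψ a) = algebraMap A R a) :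
    ∃! θ : HigherDerivation n R, ∀ a, θ.toRingHom (algebraMap A R a) = ψ a := by
  let _ : Algebra A (MvPowerSeries (Fin n) R) := ψ.toAlgebra
  let I : Ideal (MvPowerSeries (Fin n) R) :=
    Ideal.span (Set.range (MvPowerSeries.X (σ := Fin n) (R := R)))
  have hX : ∀ x ∈ I, MvPowerSeries.constantCoeff x = 0 := by
    intro x hx
    have : I ≤ RingHom.ker (MvPowerSeries.constantCoeff (σ := Fin n) (R := R)) := by
      rw [Ideal.span_le]
      rintro _ ⟨i, rfl⟩
      simp
    exact this hx
  let f : R →ₐ[A] MvPowerSeries (Fin n) R ⧸ I :=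
    { (Ideal.Quotient.mk I).comp MvPowerSeries.C with
      commutes' := fun a => by
        change Ideal.Quotient.mk I (MvPowerSeries.C (algebraMap A R a)) =
          Ideal.Quotient.mk I (ψ a)
        exact mk_eq_mk_of_constantCoeff_eq (by simp [hψ]) }
  obtain ⟨g, hg⟩ := Algebra.FormallySmooth.exists_mkₐ_comp_eq_of_isAdicComplete f
  refine ⟨⟨g.toRingHom, fun r => ?_⟩, fun a => g.commutes a, ?_⟩
  · have h1 : Ideal.Quotient.mk I (g r) = Ideal.Quotient.mk I (MvPowerSeries.C r) :=
      DFunLike.congr_fun hg r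
    have h2 := hX _ (Ideal.Quotient.eq.mp h1)
    simpa [sub_eq_zero] using h2
  · rintro ⟨θ, hθ⟩ h
    let g' : R →ₐ[A] MvPowerSeries (Fin n) R := { θ with commutes' := h }
    have : g' = g := by
      refine Algebra.FormallyUnramified.ext_of_iInf (I := I) ?_ fun x => ?_
      · have := (inferInstance : IsHausdorff I (MvPowerSeries (Fin n) R))
        simpa using this.iInf_pow_smul
      · have h1 : Ideal.Quotient.mk I (g x) = Ideal.Quotient.mk I (MvPowerSeries.C x) :=
          DFunLike.congr_fun hg x
        rw [h1]
        exact mk_eq_mk_of_constantCoeff_eq ((hθ x).trans (MvPowerSeries.constantCoeff_C x).symm)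
    have h3 : θ = g.toRingHom := RingHom.ext fun x => DFunLike.congr_fun this x
    subst h3
    rfl

open scoped IntermediateField.algebraAdjoinAdjoin in
/-- For a separating transcendence basis `t` of `F` over `K` there is exactly one higher derivation
on `F` that extends the higher derivation with respect to `t` on `K[t]`. -/
theorem IsSeparatingTranscendenceBasis.existsUnique_theta {K F : Type*} [Field K] [Field F]
    [Algebra K F] {n : ℕ} {t : Fin n → F} (ht : IsSeparatingTranscendenceBasis K t) :
    ∃! θ : HigherDerivation n F, θ.ExtendsWithRespectTo K t := by
  let A := Algebra.adjoin K (Set.range t)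
  let L := IntermediateField.adjoin K (Set.range t)
  have hsep : Algebra.IsSeparable L F := ht.isSeparable
  have hfrac : IsFractionRing A L := inferInstance
  have : Algebra.FormallyEtale A L := Algebra.FormallyEtale.of_isLocalization (nonZeroDivisors A)
  have : Algebra.FormallyEtale L F := Algebra.FormallyEtale.of_isSeparable L F
  have : Algebra.FormallyEtale A F := Algebra.FormallyEtale.comp A L F
  let e : MvPolynomial (Fin n) K ≃ₐ[K] A := ht.isTranscendenceBasis.1.aevalEquiv
  have he : ∀ p, algebraMap A F (e p) = MvPolynomial.aeval t p := fun p =>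
    ht.isTranscendenceBasis.1.algebraMap_aevalEquiv p
  let ψ₀ : MvPolynomial (Fin n) K →+* MvPowerSeries (Fin n) F :=
    MvPolynomial.eval₂Hom (MvPowerSeries.C.comp (algebraMap K F))
      (fun i => MvPowerSeries.C (t i) + MvPowerSeries.X i)
  have hψ₀ : ∀ p, MvPowerSeries.constantCoeff (ψ₀ p) = MvPolynomial.aeval t p := by
    intro p
    have : (MvPowerSeries.constantCoeff).comp ψ₀ = (MvPolynomial.aeval (R := K) t).toRingHom := by
      apply MvPolynomial.ringHom_ext <;> intro <;> simp [ψ₀]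
    exact DFunLike.congr_fun this p
  let ψ : A →+* MvPowerSeries (Fin n) F := ψ₀.comp e.symm.toRingEquiv.toRingHom
  have hψ : ∀ p, ψ (e p) = ψ₀ p := fun p => congrArg ψ₀ (e.symm_apply_apply p)
  have key : ∀ θ : HigherDerivation n F,
      (∀ a, θ.toRingHom (algebraMap A F a) = ψ a) ↔ θ.ExtendsWithRespectTo K t := by
    intro θ
    have h1 : (∀ a, θ.toRingHom (algebraMap A F a) = ψ a) ↔
        ∀ p, θ.toRingHom (MvPolynomial.aeval t p) = ψ₀ p := by
      rw [e.surjective.forall]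
      simp only [he, hψ]
    rw [h1]
    constructor
    · intro h
      refine ⟨fun a => ?_, fun i => ?_⟩
      · simpa [ψ₀] using h (MvPolynomial.C a)
      · simpa [ψ₀] using h (MvPolynomial.X i)
    · intro h p
      have : θ.toRingHom.comp (MvPolynomial.aeval (R := K) t).toRingHom = ψ₀ := by
        apply MvPolynomial.ringHom_ext
        · intro a
          simpa [ψ₀] using h.map_algebraMap a
        · intro i
          simpa [ψ₀] using h.map_basis i
      exact DFunLike.congr_fun this p
  rw [← existsUnique_congr key]
  refine HigherDerivation.existsUnique_extension ψ fun a => ?_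
  obtain ⟨p, rfl⟩ := e.surjective a
  rw [hψ, hψ₀, he]

/-- The higher derivation `θ_t : F → F[[T_1, …, T_n]]` with respect to a separating transcendence
basis `t` of `F` over `K`: the unique higher derivation on `F` with `θ_t(a) = a` for `a ∈ K` and
`θ_t(t_i) = t_i + T_i`. -/
noncomputable def IsSeparatingTranscendenceBasis.theta {K F : Type*} [Field K] [Field F]
    [Algebra K F] {n : ℕ} {t : Fin n → F} (ht : IsSeparatingTranscendenceBasis K t) :
    HigherDerivation n F :=
  ht.existsUnique_theta.choose

theorem IsSeparatingTranscendenceBasis.theta_extends {K F : Type*} [Field K] [Field F]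
    [Algebra K F] {n : ℕ} {t : Fin n → F} (ht : IsSeparatingTranscendenceBasis K t) :
    ht.theta.ExtendsWithRespectTo K t :=
  ht.existsUnique_theta.choose_spec.1

theorem IsSeparatingTranscendenceBasis.theta_unique {K F : Type*} [Field K] [Field F]
    [Algebra K F] {n : ℕ} {t : Fin n → F} (ht : IsSeparatingTranscendenceBasis K t)
    {θ : HigherDerivation n F} (hθ : θ.ExtendsWithRespectTo K t) : θ = ht.theta :=
  ht.existsUnique_theta.choose_spec.2 θ hθ

/-- The Jacobian matrix `J(f, s)` of a tuple `f` with respect to a separating transcendence basis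
`s`: its entry in row `j` and column `l` is the first partial derivative
`∂f_j/∂s_l = θ_s^(e_l)(f_j)`. -/
noncomputable def IsSeparatingTranscendenceBasis.jacobian {K F : Type*} [Field K] [Field F]
    [Algebra K F] {n : ℕ} {s : Fin n → F} (hs : IsSeparatingTranscendenceBasis K s)
    (f : Fin n → F) : Matrix (Fin n) (Fin n) F :=
  Matrix.of fun j l => hs.theta.component (Finsupp.single l 1) (f j)

/-! Put `h_l = θ_t(s_l) - s_l`, a power series without constant term. Higher derivations trivial on
`K` are determined by their values on `s`, so `θ_t` is `θ_s` followed by the substitution `T_l ↦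
h_l` (`theta_eq_subst`). Applied to `t_j`, this reads `T_j = ∑_{λ ≠ 0} θ_s^(λ)(t_j) h^λ`: the tuple
`h` is a compositional inverse.

The coefficient at `T^ν` gives a linear system with matrix `J(t,s)` for the `ν`-th coefficients of
the `h_l`; the terms with `|λ| ≥ 2` involve only coefficients of lower degree. Cramer's rule solves
it at the cost of one factor `d = det J(t,s)⁻¹`, and induction bounds the degree in `d` by `2|ν| -
1` (`coeff_mem_polynomialValues_of_inverse`), which is at most the binomial coefficient. Running the
recursion once in the product of all the fields `F` yields a single `P` for all of them. -/

/-- The additive subgroup of `R` of all values `p(d)` of polynomials `p` of degree at most `k` with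
coefficients in `A`. -/
noncomputable def polynomialValues {A R : Type*} [CommRing A] [CommRing R] (f : A →+* R) (d : R)
    (k : ℕ) : AddSubgroup R :=
  (Polynomial.degreeLE A k).toAddSubgroup.map (Polynomial.eval₂RingHom f d).toAddMonoidHom

/-! ### Calculus of degree bounds in `d` -/

section PolynomialValues

variable {A R : Type*} [CommRing A] [CommRing R] {f : A →+* R} {d : R}

theorem mem_polynomialValues {k : ℕ} {x : R} :
    x ∈ polynomialValues f d k ↔ ∃ p : Polynomial A, p.natDegree ≤ k ∧ p.eval₂ f d = x := by
  simp [polynomialValues, AddSubgroup.mem_map, Polynomial.mem_degreeLE,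
    Polynomial.natDegree_le_iff_degree_le]

theorem polynomialValues_mono {k l : ℕ} (h : k ≤ l) :
    polynomialValues f d k ≤ polynomialValues f d l := by
  intro x
  simp only [mem_polynomialValues]
  rintro ⟨p, hp, rfl⟩
  exact ⟨p, hp.trans h, rfl⟩

theorem mul_mem_polynomialValues {k l : ℕ} {x y : R} (hx : x ∈ polynomialValues f d k)
    (hy : y ∈ polynomialValues f d l) : x * y ∈ polynomialValues f d (k + l) := by
  rw [mem_polynomialValues] at *
  obtain ⟨p, hp, rfl⟩ := hx
  obtain ⟨q, hq, rfl⟩ := hy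
  exact ⟨p * q, Polynomial.natDegree_mul_le.trans (add_le_add hp hq), Polynomial.eval₂_mul f d⟩

theorem map_mem_polynomialValues (a : A) (k : ℕ) : f a ∈ polynomialValues f d k :=
  mem_polynomialValues.mpr ⟨Polynomial.C a, by simp, by simp⟩

theorem self_mem_polynomialValues : d ∈ polynomialValues f d 1 :=
  mem_polynomialValues.mpr ⟨Polynomial.X, Polynomial.natDegree_X_le, by simp⟩

end PolynomialValues

/-! ### Recursion for the inverse of a tuple of power series -/

section PowerSeries

open MvPowerSeries Finset Matrix

variable {n : ℕ} {R : Type*} [CommRing R] {h : Fin n → MvPowerSeries (Fin n) R}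

theorem coeff_multisetProd_eq_zero (h0 : ∀ i, constantCoeff (h i) = 0) (s : Multiset (Fin n))
    (ν : Fin n →₀ ℕ) (hν : ν.degree < s.card) : coeff ν (s.map h).prod = 0 := by
  induction s using Multiset.induction generalizing ν with
  | empty => simp at hν
  | cons i s ih =>
    rw [Multiset.map_cons, Multiset.prod_cons, coeff_mul]
    refine sum_eq_zero fun p hp => ?_
    rw [HasAntidiagonal.mem_antidiagonal] at hp
    by_cases hp1 : p.1 = 0
    · simp [hp1, h0]
    · rw [ih, mul_zero]
      have h1 := mt (Finsupp.degree_eq_zero_iff p.1).mp hp1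
      have h2 := congrArg Finsupp.degree hp
      rw [map_add] at h2
      rw [Multiset.card_cons] at hν
      omega

/-- A product of `r` coefficients of degrees `ν_1 + ... + ν_r = ν` has degree at most `∑ (2|ν_k| -
1) = 2|ν| - r` in `d`. All `|ν_k|` are positive, so each is at most `|ν| - r + 1`, which `hν` makes
smaller than `M`. -/
theorem coeff_multisetProd_mem {A : Type*} [CommRing A] {f : A →+* R} {d : R}
    (h0 : ∀ i, constantCoeff (h i) = 0) {M : ℕ}
    (hM : ∀ ν : Fin n →₀ ℕ, 0 < ν.degree → ν.degree < M →
      ∀ i, coeff ν (h i) ∈ polynomialValues f d (2 * ν.degree - 1))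
    (s : Multiset (Fin n)) (ν : Fin n →₀ ℕ) (hν : ν.degree + 1 < M + s.card) :
    coeff ν (s.map h).prod ∈ polynomialValues f d (2 * ν.degree - s.card) := by
  induction s using Multiset.induction generalizing ν with
  | empty =>
    classical
    rw [Multiset.map_zero, Multiset.prod_zero, coeff_one]
    split_ifs
    · simpa using map_mem_polynomialValues (f := f) (d := d) 1 _
    · exact zero_mem _
  | cons i s ih =>
    rw [Multiset.map_cons, Multiset.prod_cons, coeff_mul]
    refine sum_mem fun p hp => ?_
    rw [HasAntidiagonal.mem_antidiagonal] at hp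
    have h2 := congrArg Finsupp.degree hp
    rw [map_add] at h2
    rw [Multiset.card_cons] at hν ⊢
    by_cases hp1 : p.1 = 0
    · simp [hp1, h0]
    have h1 := mt (Finsupp.degree_eq_zero_iff p.1).mp hp1
    -- Where the truncated subtraction `2 * p.2.degree - s.card` could lose information, the
    -- coefficient vanishes.
    rcases lt_or_ge p.2.degree s.card with h3 | h3
    · simp [coeff_multisetProd_eq_zero h0 s p.2 h3]
    · exact polynomialValues_mono (by omega)
        (mul_mem_polynomialValues (hM p.1 (by omega) (by omega) i) (ih p.2 (by omega)))

theorem prod_pow_eq_multisetProd (lam : Fin n →₀ ℕ) :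
    ∏ l, h l ^ lam l = ((Finsupp.toMultiset lam).map h).prod := by
  rw [Finsupp.toMultiset_map, Finsupp.prod_toMultiset, Finsupp.prod_mapDomain_index
    (fun _ => pow_zero _) (fun _ _ _ => pow_add _ _ _), Finsupp.prod_fintype _ _
    (fun _ => pow_zero _)]

theorem card_toMultiset_eq_degree (lam : Fin n →₀ ℕ) :
    (Finsupp.toMultiset lam).card = lam.degree := by
  simp [Finsupp.card_toMultiset, Finsupp.degree_apply, Finsupp.sum]

/-- The exponents of total degree at most `m`. -/
noncomputable def exponentsLE (n m : ℕ) : Finset (Fin n →₀ ℕ) :=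
  (Finsupp.finite_of_degree_le (σ := Fin n) m).toFinset

theorem mem_exponentsLE {m : ℕ} {lam : Fin n →₀ ℕ} : lam ∈ exponentsLE n m ↔ lam.degree ≤ m := by
  simp [exponentsLE]

/-- The part of degree at least two in the `ν`-th coefficient of the composition of
`∑ c_λ T^λ` with `h`. -/
noncomputable def higherPart (m : ℕ) (h : Fin n → MvPowerSeries (Fin n) R)
    (c : (Fin n →₀ ℕ) → R) (ν : Fin n →₀ ℕ) : R :=
  ∑ lam ∈ exponentsLE n m with 2 ≤ lam.degree, c lam * coeff ν (∏ l, h l ^ lam l)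

theorem sum_exponentsLE_eq_linear_add_higherPart {m : ℕ} (hm : 1 ≤ m) (c : (Fin n →₀ ℕ) → R)
    {ν : Fin n →₀ ℕ} (hν : ν ≠ 0) :
    ∑ lam ∈ exponentsLE n m, c lam * coeff ν (∏ l, h l ^ lam l) =
      ∑ l, c (Finsupp.single l 1) * coeff ν (h l) + higherPart m h c ν := by
  classical
  rw [← sum_filter_not_add_sum_filter _ (fun lam => 2 ≤ lam.degree), higherPart]
  congr 1
  have hsingle : ∀ l, ∏ k, h k ^ (Finsupp.single l 1 : Fin n →₀ ℕ) k = h l := fun l => by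
    rw [prod_pow_eq_multisetProd]
    simp
  calc _ = ∑ lam ∈ univ.image (fun l : Fin n => Finsupp.single l 1),
        c lam * coeff ν (∏ l, h l ^ lam l) := by
        symm
        refine sum_subset ?_ ?_
        · intro lam
          simp only [mem_image, mem_univ, true_and, mem_filter, mem_exponentsLE]
          rintro ⟨l, rfl⟩
          simp [hm]
        · intro lam hlam hlam'
          have h0 : lam = 0 := by
            rw [mem_filter, not_le] at hlam
            rw [← Finsupp.degree_eq_zero_iff]
            by_contra hne
            have h1 : lam ∈ {d : Fin n →₀ ℕ | d.degree = 1} := by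
              change lam.degree = 1
              omega
            rw [← Finsupp.range_single_one] at h1
            exact hlam' (by simpa using h1)
          subst h0
          simp [coeff_one, hν]
    _ = _ := by
        rw [sum_image (fun a _ b _ hab => Finsupp.single_left_injective one_ne_zero hab)]
        simp only [hsingle]

theorem higherPart_eq_zero (h0 : ∀ i, constantCoeff (h i) = 0) {m : ℕ} (c : (Fin n →₀ ℕ) → R)
    {ν : Fin n →₀ ℕ} (hν : ν.degree = 1) : higherPart m h c ν = 0 := by
  refine sum_eq_zero fun lam hlam => ?_
  rw [prod_pow_eq_multisetProd, coeff_multisetProd_eq_zero h0, mul_zero]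
  rw [card_toMultiset_eq_degree, hν]
  exact (mem_filter.mp hlam).2

/-- If `h` has zero constant terms and is inverted by the tuple of power series with coefficients
`c` up to degree `m`, then a coefficient of degree `k ≤ m` of `h` is a polynomial of degree at most
`2 k - 1` in the inverse of the determinant of the linear part of `c`. -/
theorem coeff_mem_polynomialValues_of_inverse {A : Type*} [CommRing A] {f : A →+* R} {d : R}
    {m : ℕ} (h0 : ∀ i, constantCoeff (h i) = 0) (a : (Fin n →₀ ℕ) → Fin n → A)
    (c : (Fin n →₀ ℕ) → Fin n → R)
    (hac : ∀ lam : Fin n →₀ ℕ, 0 < lam.degree → lam.degree ≤ m → ∀ j, f (a lam j) = c lam j)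
    (hd : d * (Matrix.of fun j l => c (Finsupp.single l 1) j).det = 1)
    (hc : ∀ ν : Fin n →₀ ℕ, ν ≠ 0 → ν.degree ≤ m → ∀ j,
      ∑ lam ∈ exponentsLE n m, c lam j * coeff ν (∏ l, h l ^ lam l) = coeff ν (X j))
    (ν : Fin n →₀ ℕ) (hν : 0 < ν.degree) (hνm : ν.degree ≤ m) (i : Fin n) :
    coeff ν (h i) ∈ polynomialValues f d (2 * ν.degree - 1) := by
  induction hk : ν.degree using Nat.strong_induction_on generalizing ν i with
  | _ M ih =>
  subst hk
  let J : Matrix (Fin n) (Fin n) A := Matrix.of fun j l => a (Finsupp.single l 1) j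
  let v : Fin n → R := fun l => coeff ν (h l)
  let w : Fin n → R := fun j => coeff ν (X j) - higherPart m h (c · j) ν
  have hJ : (Matrix.of fun j l => c (Finsupp.single l 1) j) = f.mapMatrix J := by
    ext j l
    simp only [J, Matrix.of_apply, RingHom.mapMatrix_apply, Matrix.map_apply]
    rw [hac _ (by simp) (by simp; omega)]
  have hlin : f.mapMatrix J *ᵥ v = w := by
    ext j
    have h1 := hc ν (by rintro rfl; simp at hν) hνm j
    rw [sum_exponentsLE_eq_linear_add_higherPart (by omega) (c · j)
      (by rintro rfl; simp at hν)] at h1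
    simp only [w, ← h1, ← hJ, v, Matrix.mulVec, dotProduct, Matrix.of_apply, add_sub_cancel_right]
  -- Cramer's rule: the adjugate has entries in the image of `A`, so only the factor `d` raises the
  -- degree.
  have hv : coeff ν (h i) = d * ∑ j, f (J.adjugate i j) * w j := by
    have h1 : d • ((f.mapMatrix J).adjugate *ᵥ w) = v := by
      rw [← hlin, Matrix.mulVec_mulVec, Matrix.adjugate_mul, Matrix.smul_mulVec,
        Matrix.one_mulVec, smul_smul, ← hJ, hd, one_smul]
    rw [← RingHom.map_adjugate] at h1
    exact (congrFun h1 i).symm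
  -- Each product in the higher part has `|λ| ≥ 2` factors, whence `2|ν| - |λ| ≤ 2|ν| - 2`.
  have hw : ∀ j, w j ∈ polynomialValues f d (2 * ν.degree - 2) := by
    intro j
    classical
    refine sub_mem ?_ (sum_mem fun lam hlam => ?_)
    · rw [coeff_X]
      split_ifs
      · simpa using map_mem_polynomialValues (f := f) (d := d) 1 _
      · exact zero_mem _
    · rw [mem_filter, mem_exponentsLE] at hlam
      beta_reduce
      rw [← hac lam (by omega) hlam.1, prod_pow_eq_multisetProd]
      have h1 := coeff_multisetProd_mem (f := f) (d := d) h0 (M := ν.degree)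
        (fun ν' h1 h2 i => ih _ h2 ν' h1 (by omega) i rfl) (Finsupp.toMultiset lam) ν
        (by rw [card_toMultiset_eq_degree]; omega)
      rw [card_toMultiset_eq_degree] at h1
      exact polynomialValues_mono (by omega)
        (mul_mem_polynomialValues (map_mem_polynomialValues _ 0) h1)
  rw [hv]
  refine polynomialValues_mono (k := 1 + (0 + (2 * ν.degree - 2))) (by omega)
    (mul_mem_polynomialValues self_mem_polynomialValues (sum_mem fun j _ => ?_))
  exact mul_mem_polynomialValues (map_mem_polynomialValues _ 0) (hw j)

end PowerSeries

/-- The worst case is `n = 1`, where the right side is the binomial coefficient `(m+1 choose 2)`,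
quadratic in `m`. -/
theorem two_mul_sub_one_le_choose {n m : ℕ} (hn : 1 ≤ n) (hm : 1 ≤ m) :
    2 * m - 1 ≤ (n + m).choose (n + 1) := by
  obtain ⟨k, rfl⟩ := Nat.exists_eq_add_of_le' hm
  have h1 : (k + 2).choose k ≤ (n + (k + 1)).choose k := Nat.choose_le_choose k (by omega)
  have h2 : (n + (k + 1)).choose (n + 1) = (n + (k + 1)).choose k :=
    Nat.choose_symm_of_eq_add (by omega)
  have h3 : (k + 2).choose k = (k + 2).choose 2 := Nat.choose_symm_of_eq_add (by omega)
  rw [h2]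
  refine le_trans ?_ h1
  rw [h3]
  clear h1 h2 h3
  induction k with
  | zero => simp
  | succ k ih =>
    rw [Nat.choose_succ_succ' (k + 2) 1, Nat.choose_one_right]
    norm_num at ih ⊢
    omega

open scoped IntermediateField.algebraAdjoinAdjoin in
/-- A higher derivation on `F` that is trivial on `K` is determined by its values on a separating
transcendence basis. -/
theorem IsSeparatingTranscendenceBasis.higherDerivation_ext {K F : Type*} [Field K] [Field F]
    [Algebra K F] {n : ℕ} {s : Fin n → F} (hs : IsSeparatingTranscendenceBasis K s)
    {θ θ' : HigherDerivation n F}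
    (hθ : ∀ a : K, θ.toRingHom (algebraMap K F a) = MvPowerSeries.C (algebraMap K F a))
    (hθ' : ∀ a : K, θ'.toRingHom (algebraMap K F a) = MvPowerSeries.C (algebraMap K F a))
    (h : ∀ i, θ.toRingHom (s i) = θ'.toRingHom (s i)) : θ = θ' := by
  let A := Algebra.adjoin K (Set.range s)
  let L := IntermediateField.adjoin K (Set.range s)
  have hsep : Algebra.IsSeparable L F := hs.isSeparable
  have hfrac : IsFractionRing A L := inferInstance
  have : Algebra.FormallyEtale A L := Algebra.FormallyEtale.of_isLocalization (nonZeroDivisors A)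
  have : Algebra.FormallyEtale L F := Algebra.FormallyEtale.of_isSeparable L F
  have : Algebra.FormallyEtale A F := Algebra.FormallyEtale.comp A L F
  -- `F` is formally étale over `K[s]`, so it suffices to compare on `K[s]`, hence on generators.
  refine (HigherDerivation.existsUnique_extension (A := A)
    (θ'.toRingHom.comp (algebraMap A F))
    fun a => θ'.constantCoeff_toRingHom _).unique (fun a => ?_) fun a => rfl
  change θ.toRingHom a.1 = θ'.toRingHom a.1
  refine Algebra.adjoin_induction (p := fun x _ => θ.toRingHom x = θ'.toRingHom x) ?_ ?_ ?_ ?_ a.2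
  · rintro _ ⟨i, rfl⟩
    exact h i
  · intro r
    rw [hθ, hθ']
  · intro x y _ _ hx hy
    rw [map_add, map_add, hx, hy]
  · intro x y _ _ hx hy
    rw [map_mul, map_mul, hx, hy]

/-! ### Comparison of `θ_s` and `θ_t` -/

section ChangeOfBasis

open MvPowerSeries

variable {K F : Type*} [Field K] [Field F] [Algebra K F] {n : ℕ} {s t : Fin n → F}

/-- The power series `θ_t(s_i) - s_i`, whose `T^α`-coefficient for `α ≠ 0` is `θ_t^(α)(s_i)`. -/
noncomputable def IsSeparatingTranscendenceBasis.increment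
    (ht : IsSeparatingTranscendenceBasis K t) (s : Fin n → F) (i : Fin n) :
    MvPowerSeries (Fin n) F :=
  ht.theta.toRingHom (s i) - C (s i)

theorem IsSeparatingTranscendenceBasis.constantCoeff_increment
    (ht : IsSeparatingTranscendenceBasis K t) (s : Fin n → F) (i : Fin n) :
    constantCoeff (ht.increment s i) = 0 := by
  simp [increment, ht.theta.constantCoeff_toRingHom]

theorem IsSeparatingTranscendenceBasis.coeff_increment
    (ht : IsSeparatingTranscendenceBasis K t) (s : Fin n → F) (i : Fin n) {ν : Fin n →₀ ℕ}
    (hν : ν ≠ 0) : coeff ν (ht.increment s i) = ht.theta.component ν (s i) := by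
  classical
  simp [increment, HigherDerivation.component, coeff_C, hν]

/-- Taylor expansion with respect to `t` is Taylor expansion with respect to `s`, followed by
the substitution of `θ_t(s_i) - s_i` for the `i`-th variable. -/
theorem IsSeparatingTranscendenceBasis.theta_eq_subst (hs : IsSeparatingTranscendenceBasis K s)
    (ht : IsSeparatingTranscendenceBasis K t) (r : F) :
    ht.theta.toRingHom r = subst (ht.increment s) (hs.theta.toRingHom r) := by
  have ha : HasSubst (ht.increment s) :=
    hasSubst_of_constantCoeff_zero (ht.constantCoeff_increment s)
  have hC : ∀ a : F, substAlgHom (R := F) ha (C a) = C a := fun a => by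
    rw [substAlgHom_apply, subst_C]
  let φ : HigherDerivation n F :=
    { toRingHom := (substAlgHom (R := F) ha).toRingHom.comp hs.theta.toRingHom
      constantCoeff_toRingHom := fun r => by
        have h1 : constantCoeff (hs.theta.toRingHom r - C r) = 0 := by
          simp [hs.theta.constantCoeff_toRingHom]
        have h2 := constantCoeff_subst_eq_zero ha (ht.constantCoeff_increment s) h1
        rw [← substAlgHom_apply ha, map_sub, map_sub, hC, sub_eq_zero] at h2
        simpa using h2 }
  have hφ : ∀ r, φ.toRingHom r = substAlgHom (R := F) ha (hs.theta.toRingHom r) := fun _ => rfl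
  have : ht.theta = φ := by
    refine hs.higherDerivation_ext ht.theta_extends.map_algebraMap (fun a => ?_) fun i => ?_
    · rw [hφ, hs.theta_extends.map_algebraMap, hC]
    · rw [hφ, hs.theta_extends.map_basis, map_add, hC, substAlgHom_X, increment]
      abel
  rw [this, hφ, substAlgHom_apply]

/-- This is the coefficient of `T^ν` in `θ_t(t_j) = t_j + T_j`, expanded by `theta_eq_subst`.
Cutting off at `|λ| ≤ m` loses nothing, since `h^λ` has order at least `|λ|`. -/
theorem IsSeparatingTranscendenceBasis.sum_component_mul_coeff
    (hs : IsSeparatingTranscendenceBasis K s) (ht : IsSeparatingTranscendenceBasis K t) {m : ℕ}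
    {ν : Fin n →₀ ℕ} (hν : ν ≠ 0) (hm : ν.degree ≤ m) (j : Fin n) :
    ∑ lam ∈ exponentsLE n m,
      hs.theta.component lam (t j) * coeff ν (∏ l, ht.increment s l ^ lam l) = coeff ν (X j) := by
  classical
  have ha : HasSubst (ht.increment s) :=
    hasSubst_of_constantCoeff_zero (ht.constantCoeff_increment s)
  have h1 := congrArg (coeff ν) (hs.theta_eq_subst ht (t j))
  rw [ht.theta_extends.map_basis, map_add, coeff_C, if_neg hν, zero_add, coeff_subst ha] at h1
  rw [h1, finsum_eq_sum_of_support_subset (s := exponentsLE n m)]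
  · refine Finset.sum_congr rfl fun lam _ => ?_
    rw [Finsupp.prod_fintype _ _ fun _ => pow_zero _]
    rfl
  · intro lam hlam
    rw [Finset.mem_coe, mem_exponentsLE]
    by_contra hlt
    refine hlam ?_
    simp only
    rw [Finsupp.prod_fintype _ _ fun _ => pow_zero _, prod_pow_eq_multisetProd,
      coeff_multisetProd_eq_zero (ht.constantCoeff_increment s), smul_zero]
    rw [card_toMultiset_eq_degree]
    omega

/-- The chain rule: in degree one only the linear part of the substitution survives. -/
theorem IsSeparatingTranscendenceBasis.jacobian_mul_jacobian
    (hs : IsSeparatingTranscendenceBasis K s) (ht : IsSeparatingTranscendenceBasis K t) :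
    hs.jacobian t * ht.jacobian s = 1 := by
  ext j k
  have hk : (Finsupp.single k 1 : Fin n →₀ ℕ) ≠ 0 := by simp
  have h1 := hs.sum_component_mul_coeff ht (m := 1) hk (by simp) j
  rw [sum_exponentsLE_eq_linear_add_higherPart le_rfl
    (fun lam => hs.theta.component lam (t j)) hk,
    higherPart_eq_zero (ht.constantCoeff_increment s) _ (by simp), add_zero] at h1
  simp only [ht.coeff_increment s _ hk] at h1
  classical
  rw [coeff_X] at h1
  simp only [Matrix.mul_apply, jacobian, Matrix.of_apply, h1, Matrix.one_apply,
    Finsupp.single_left_inj one_ne_zero, eq_comm]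

theorem IsSeparatingTranscendenceBasis.det_jacobian_ne_zero
    (hs : IsSeparatingTranscendenceBasis K s) (ht : IsSeparatingTranscendenceBasis K t) :
    (hs.jacobian t).det ≠ 0 := by
  have h1 := congrArg Matrix.det (hs.jacobian_mul_jacobian ht)
  rw [Matrix.det_mul, Matrix.det_one] at h1
  exact left_ne_zero_of_mul_eq_one h1

end ChangeOfBasis

-- One polynomial for all fields and bases

universe u v

set_option linter.checkUnivs false in
/-- A field extension together with two separating transcendence bases of length `n`. -/
structure SeparatingBasisPair (n : ℕ) : Type (max (u + 1) (v + 1)) where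
  K : Type u
  F : Type v
  [fieldK : Field K]
  [fieldF : Field F]
  [algebra : Algebra K F]
  s : Fin n → F
  t : Fin n → F
  hs : IsSeparatingTranscendenceBasis K s
  ht : IsSeparatingTranscendenceBasis K t

attribute [instance] SeparatingBasisPair.fieldK SeparatingBasisPair.fieldF
  SeparatingBasisPair.algebra

theorem theorem4p3 (n : ℕ) (μ : Fin n →₀ ℕ) (hμ : μ ≠ 0) (i : Fin n) :
    ∃ P : Polynomial (MvPolynomial
        ({lam : Fin n →₀ ℕ // 0 < lam.degree ∧ lam.degree ≤ μ.degree} × Fin n) ℤ),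
      P.natDegree ≤ (n + μ.degree).choose (n + 1) ∧
      ∀ (K : Type*) (F : Type*) [Field K] [Field F] [Algebra K F] (s t : Fin n → F)
        (hs : IsSeparatingTranscendenceBasis K s) (ht : IsSeparatingTranscendenceBasis K t),
        (hs.jacobian t).det ≠ 0 ∧
        ht.theta.component μ (s i) =
          P.eval₂
            (MvPolynomial.eval₂Hom (Int.castRingHom F)
              fun x => hs.theta.component x.1.1 (t x.2))
            ((hs.jacobian t).det)⁻¹ := by
  classical
  -- The coefficients of all extensions and bases are treated at once, in the product of the fields.
  let R := ∀ x : SeparatingBasisPair n, x.F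
  let h : Fin n → MvPowerSeries (Fin n) R := fun l ν x =>
    MvPowerSeries.coeff ν (x.ht.increment x.s l)
  let c : (Fin n →₀ ℕ) → Fin n → R := fun lam j x => x.hs.theta.component lam (x.t j)
  let d : R := fun x => ((x.hs.jacobian x.t).det)⁻¹
  let f : MvPolynomial ({lam : Fin n →₀ ℕ // 0 < lam.degree ∧ lam.degree ≤ μ.degree} × Fin n) ℤ
      →+* R := MvPolynomial.eval₂Hom (Int.castRingHom R) fun x => c x.1.1 x.2
  let a : (Fin n →₀ ℕ) → Fin n → MvPolynomial
      ({lam : Fin n →₀ ℕ // 0 < lam.degree ∧ lam.degree ≤ μ.degree} × Fin n) ℤ := fun lam j =>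
    if hlam : 0 < lam.degree ∧ lam.degree ≤ μ.degree then MvPolynomial.X (⟨lam, hlam⟩, j) else 0
  let ev : ∀ x : SeparatingBasisPair n, R →+* x.F := fun x => Pi.evalRingHom _ x
  have hmap : ∀ x l, MvPowerSeries.map (ev x) (h l) = x.ht.increment x.s l := fun x l => by
    ext ν
    rfl
  have hμ0 : 0 < μ.degree := Nat.pos_of_ne_zero (mt (Finsupp.degree_eq_zero_iff μ).mp hμ)
  have key := coeff_mem_polynomialValues_of_inverse (f := f) (d := d) (m := μ.degree) (h := h)
    (fun l => funext fun x => x.ht.constantCoeff_increment x.s l) a c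
    (fun lam h1 h2 j => by simp [a, f, h1, h2])
    (by
      -- Identities in the product ring are checked in each factor, where `ev x` turns them into the
      -- statements for one pair of bases.
      refine funext fun x => ?_
      change ev x (d * _) = 1
      rw [map_mul, RingHom.map_det]
      exact inv_mul_cancel₀ (x.hs.det_jacobian_ne_zero x.ht))
    (fun ν hν hm j => by
      refine funext fun x => ?_
      change ev x (∑ lam ∈ exponentsLE n μ.degree, _) = ev x (MvPowerSeries.coeff ν (MvPowerSeries.X j))
      rw [map_sum, ← MvPowerSeries.coeff_map, MvPowerSeries.map_X,
        ← x.hs.sum_component_mul_coeff x.ht hν hm j]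
      refine Finset.sum_congr rfl fun lam _ => ?_
      rw [map_mul, ← MvPowerSeries.coeff_map, map_prod]
      simp only [map_pow, hmap]
      rfl)
    μ hμ0 le_rfl i
  -- `P` is chosen here, before any field is fixed; projecting `hPe` to a factor specializes it.
  obtain ⟨P, hP, hPe⟩ := mem_polynomialValues.mp key
  refine ⟨P, hP.trans (two_mul_sub_one_le_choose (Fin.pos i) hμ0), ?_⟩
  intro K F _ _ _ s t hs ht
  refine ⟨hs.det_jacobian_ne_zero ht, ?_⟩
  let x : SeparatingBasisPair n := ⟨K, F, s, t, hs, ht⟩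
  have h1 := congrArg (ev x) hPe
  rw [Polynomial.hom_eval₂] at h1
  rw [← ht.coeff_increment s i hμ]
  refine h1.symm.trans ?_
  congr 1
  refine MvPolynomial.ringHom_ext (fun k => ?_) fun y => ?_
  · simp
  · simp only [f, RingHom.comp_apply, MvPolynomial.eval₂Hom_X']
    rfl
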